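/- Let $\sigma \ge 2$ be an integer and let $c, \epsilon$ be real constants with $1-\epsilon > c > \epsilon > 0$. All strings are over a fixed alphabet of size $\sigma$. For a string $s$ of length $n$, let $H_0(s) = \frac1n \sum_{a} n_a \log_2 \frac{n}{n_a}$, the sum over the characters $a$ that occur in $s$, where $n_a$ is the number of occurrences of $a$; and let $H_k(s) = \frac1n \sum_{|w|=k} |w_s|\, H_0(w_s)$, where $w_s$ is the concatenation of the characters that immediately follow the occurrences of $w$ in $s$. A $\sigma$-ary De Bruijn sequence of order $k$ is a string that contains every word of length $k$ exactly once. A compressor in the Standard model reads its input once from left to right. On each character it updates its memory, which holds a bit string, and appends bits to its output; at the end of the input it may append some more bits. Its transitions may be arbitrary functions and may depend on the input length $n$. Let $A$ be such a compressor that is lossless (for each $n$, distinct strings of length $n$ have distinct encodings) and whose memory never holds more than $O(n^c)$ bits on inputs of length $n$. Write $A(s)$ for the encoding of $s$, and let $k = k(n) = \lceil (c+\epsilon/2) \log_\sigma n \rceil$. Then: 1. $A$ does not store every $s$ in $O(n H_k(s) + \sigma^k n^{1-c-\epsilon})$ bits. More precisely, for every constant $C$ and every sufficiently large $n$ there is a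 string $s$ of length $n$ with $|A(s)| > C\,(n H_k(s) + \sigma^k n^{1-c-\epsilon})$. 2. There is a constant $\delta > 0$ such that for every sufficiently large $n$ there is a string $d$ consisting of the first $\sigma^k$ characters of some $\sigma$-ary De Bruijn sequence of order $k$ such that the string $s$ of length $n$ that consists of consecutive copies of $d$ (the last one cut off if $\sigma^k$ does not divide $n$) satisfies $H_k(s) = 0$, while $A$ outputs at least $\delta \sigma^k$ bits while reading each complete copy of $d$ in $s$, and $|A(s)| \ge \delta n$. -/

import Mathlib

/-- The empirical entropy of order zero of a string, in bits per character:
`(1 / n) * ∑ n_a * log₂ (n / n_a)`, the sum over the characters `a` that occur in the string. -/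
noncomputable def entropyZero {α : Type} [DecidableEq α] (s : List α) : ℝ :=
  (1 / (s.length : ℝ)) *
    ∑ a ∈ s.toFinset, (s.count a : ℝ) * Real.logb 2 ((s.length : ℝ) / (s.count a : ℝ))

/-- The string `w_s` of the characters that immediately follow the (possibly overlapping)
occurrences of `w` in `s`. -/
def followers {α : Type} [DecidableEq α] (w s : List α) : List α :=
  ((List.range (s.length - w.length)).filter
      (fun i => decide ((s.drop i).take w.length = w))).filterMap
    (fun i => s[i + w.length]?)

/-- The empirical entropy of order `k` of a string:
`(1 / n) * ∑ |w_s| * H₀ (w_s)`, the sum over all words `w` of length `k`.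
For `k = 0` the only word is the empty one, `w_s = s`, and this is `H₀ (s)`. -/
noncomputable def entropyOrder {α : Type} [Fintype α] [DecidableEq α] (k : ℕ) (s : List α) : ℝ :=
  (1 / (s.length : ℝ)) *
    ∑ w : Fin k → α,
      ((followers (List.ofFn w) s).length : ℝ) * entropyZero (followers (List.ofFn w) s)

/-- A `σ`-ary De Bruijn sequence of order `k`: every word of length `k` occurs in it,
as a contiguous substring, exactly once. (For `k ≥ 1` its length is then `σ ^ k + k - 1`.) -/
def IsDeBruijnSequence (σ k : ℕ) (b : List (Fin σ)) : Prop :=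
  ∀ w : List (Fin σ), w.length = k →
    ∃! i : ℕ, i + k ≤ b.length ∧ (b.drop i).take k = w

/-- The string of length `n` that consists of copies of `d`, one after the other; the last one
is cut off if the length of `d` does not divide `n`. -/
def repeatToLength {α : Type} (d : List α) (n : ℕ) : List α :=
  (List.replicate (n / d.length) d).flatten ++ d.take (n % d.length)

/-- A compressor in the Standard (one-pass) streaming model. The content of its memory is a bit
string. It reads the input once from left to right; on each character it replaces the content
of its memory and appends finitely many bits to its output. At the end of the input it may
append some more bits. The transitions are arbitrary functions, so that every deterministic
one-pass algorithm is included, whatever it does between two reads. -/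
structure OnePassCompressor (α : Type) where
  /-- the initial content of the memory -/
  init : List Bool
  /-- from the memory and the next character: the new memory, and the bits that are output -/
  step : List Bool → α → List Bool × List Bool
  /-- the bits that are output at the end of the input -/
  finish : List Bool → List Bool

namespace OnePassCompressor

variable {α : Type}

/-- The content of the memory after reading a string, starting with memory `m`. -/
def memoryAfter (A : OnePassCompressor α) (m : List Bool) (t : List α) : List Bool :=
  t.foldl (fun m a => (A.step m a).1) m

/-- The bits output while reading a string, starting with memory `m`. -/
def outputWhile (A : OnePassCompressor α) : List Bool → List α → List Bool
  | _, [] => []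
  | m, a :: t => (A.step m a).2 ++ A.outputWhile (A.step m a).1 t

/-- The encoding of a string: the whole output on it. -/
def encode (A : OnePassCompressor α) (s : List α) : List Bool :=
  A.outputWhile A.init s ++ A.finish (A.memoryAfter A.init s)

/-- On every input of length `n`, the memory never holds more than `B` bits. -/
def MemoryAtMost (A : OnePassCompressor α) (n : ℕ) (B : ℝ) : Prop :=
  ∀ s : List α, s.length = n → ∀ t : List α, t <+: s →
    ((A.memoryAfter A.init t).length : ℝ) ≤ B

/-- Every input of length `n` can be recovered from its encoding (and `n`). -/
def LosslessAt (A : OnePassCompressor α) (n : ℕ) : Prop :=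
  ∀ s t : List α, s.length = n → t.length = n → A.encode s = A.encode t → s = t

end OnePassCompressor

/-! Fix `n`, and let the memory hold at most `B` bits. Suppose that for every `d` in a family of
words of one length the compressor outputs at most `U` bits on some copy of `d` in the repetition of
`d`. The memory before that copy, the memory after it and the output on it then determine `d`:
otherwise, in one input, `d` could be exchanged for another word without changing the encoding. Only
the memory matters, not the position, so the copy may depend on `d`. Hence the family has fewer than
`2 ^ (2 * (B + 1) + (U + 1))` members (`OnePassCompressor.exists_long_output`).

There are at least `2 ^ σ ^ (k - 4)` De Bruijn periods of order `k`
(`exists_injective_isPeriodicDeBruijn`), and `n ^ c` is far below `σ ^ k`, so for some period every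
complete copy costs on the order of `σ ^ k` bits. Its repetition has `H_k = 0`, since a word of
length `k` determines the next letter.

For the count, De Bruijn periods are read off single-cycle permutations `F` of the words of length
`k` that delete the first letter and append one. On the words `x b b a t` the appended letter may be
prescribed as a function of `x` and `t`, one bit for each `t`. All cycles can still be joined by
transpositions of other words that differ only in the first letter
(`exists_single_cycle_shiftPerm`). -/

/-! ### Joining cycles of a permutation. -/

/-- Composing with the transposition of two points of different cycles joins these cycles. -/
theorem Equiv.Perm.sameCycle_mul_swap_of_not_sameCycle {β : Type*} [Finite β] [DecidableEq β]
    {f : Equiv.Perm β} {x y : β} (h : ¬ f.SameCycle x y) :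
    (f * Equiv.swap x y).SameCycle x y := by
  by_contra hR
  -- The product sends `x` to `f y` and then follows the `f`-orbit of `y` until it meets `x` or `y`.
  -- It cannot meet `x`, and the orbit does return to `y`.
  have key : ∀ j : ℕ, (f * Equiv.swap x y).SameCycle x ((f ^ (j + 1)) y) := by
    intro j
    induction j with
    | zero => exact ⟨1, by simp⟩
    | succ j ih =>
      have hy : (f ^ (j + 1)) y ≠ y := fun e => hR (by rwa [e] at ih)
      have hx : (f ^ (j + 1)) y ≠ x := fun e => h (SameCycle.symm ⟨(j + 1 : ℕ), by rw [zpow_natCast]; exact e⟩)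
      have : (f ^ (j + 1 + 1)) y = (f * Equiv.swap x y) ((f ^ (j + 1)) y) := by
        rw [Equiv.Perm.mul_apply, Equiv.swap_apply_of_ne_of_ne hx hy, pow_succ' f (j + 1),
          Equiv.Perm.mul_apply]
      rw [this]
      exact Equiv.Perm.sameCycle_apply_right.2 ih
  have h1 := key (orderOf f - 1)
  rw [Nat.sub_add_cancel (orderOf_pos f), pow_orderOf_eq_one] at h1
  exact hR h1

/-- Joining two cycles by a transposition does not split any cycle. -/
theorem Equiv.Perm.SameCycle.mul_swap {β : Type*} [Finite β] [DecidableEq β]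
    {f : Equiv.Perm β} {x y : β} (h : ¬ f.SameCycle x y) {z w : β} (hzw : f.SameCycle z w) :
    (f * Equiv.swap x y).SameCycle z w := by
  have hxy := Equiv.Perm.sameCycle_mul_swap_of_not_sameCycle h
  have step : ∀ t, (f * Equiv.swap x y).SameCycle t (f t) := by
    intro t
    by_cases hx : t = x
    · subst hx
      have : f t = (f * Equiv.swap t y) y := by simp
      rw [this]
      exact Equiv.Perm.sameCycle_apply_right.2 hxy
    by_cases hy : t = y
    · subst hy
      have : f t = (f * Equiv.swap x t) x := by simp
      rw [this]
      exact Equiv.Perm.sameCycle_apply_right.2 hxy.symm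
    · have : f t = (f * Equiv.swap x y) t := by
        rw [Equiv.Perm.mul_apply, Equiv.swap_apply_of_ne_of_ne hx hy]
      rw [this]
      exact Equiv.Perm.sameCycle_apply_right.2 (Equiv.Perm.SameCycle.refl _ _)
  obtain ⟨i, -, rfl⟩ := hzw.exists_pow_eq'
  clear hzw
  induction i with
  | zero => exact Equiv.Perm.SameCycle.refl _ _
  | succ i ih =>
    rw [pow_succ', Equiv.Perm.mul_apply]
    exact ih.trans (step _)

/-! ### Many shift permutations with a single cycle. -/

section ShiftPerm

variable {α : Type}

/-- A permutation of the words of length `m + 1` that removes the first letter of a word and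
appends a letter to it. -/
def IsShiftPerm {m : ℕ} (F : Equiv.Perm (Fin (m + 1) → α)) : Prop :=
  ∀ w, ∀ j : Fin m, F w j.castSucc = w j.succ

/-- A weight of words that decreases when the first letter is removed and the letter `a`
is appended. -/
def shiftWeight [DecidableEq α] (a : α) {m : ℕ} (w : Fin (m + 1) → α) : ℕ :=
  ∑ i : Fin (m + 1), if w i = a then 0 else if (i : ℕ) = 0 then 0 else m + i

/-- A letter other than `a` loses `m + 1` when it moves from position 1 to position 0, and 1 in
every other move; in the last position it costs `2 * m`. The deleted letter had weight 0. -/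
theorem shiftWeight_shift [DecidableEq α] (a : α) {m : ℕ} (hm : 0 < m)
    (w w' : Fin (m + 1) → α) (h : ∀ j : Fin m, w' j.castSucc = w j.succ) :
    shiftWeight a w' +
        ∑ j : Fin m, (if w j.succ = a then 0 else if (j : ℕ) = 0 then m + 1 else 1) =
      shiftWeight a w + if w' (Fin.last m) = a then 0 else 2 * m := by
  unfold shiftWeight
  rw [Fin.sum_univ_castSucc, Fin.sum_univ_succ (fun i : Fin (m + 1) =>
    if w i = a then 0 else if (i : ℕ) = 0 then 0 else m + i), add_right_comm,
    ← Finset.sum_add_distrib]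
  have : ∀ j : Fin m, ((if w' j.castSucc = a then 0 else
      if ((j.castSucc : Fin (m + 1)) : ℕ) = 0 then 0 else m + (j.castSucc : Fin (m + 1))) +
      (if w j.succ = a then 0 else if (j : ℕ) = 0 then m + 1 else 1)) =
      if w j.succ = a then 0 else
        if ((j.succ : Fin (m + 1)) : ℕ) = 0 then 0 else m + (j.succ : Fin (m + 1)) := by
    intro j
    rw [h j]
    simp only [Fin.val_castSucc, Fin.val_succ]
    split_ifs <;> omega
  rw [Finset.sum_congr rfl fun j _ => this j]
  simp only [Fin.val_last, Fin.val_zero, if_true, ite_self, zero_add]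
  split_ifs <;> omega

theorem shiftWeight_shift_lt [DecidableEq α] (a : α) {m : ℕ}
    (w w' : Fin (m + 1) → α) (h : ∀ j : Fin m, w' j.castSucc = w j.succ)
    (hlast : w' (Fin.last m) = a) (j : Fin m) (hj : w j.succ ≠ a) :
    shiftWeight a w' < shiftWeight a w := by
  have h1 := shiftWeight_shift a (Fin.pos j) w w' h
  rw [if_pos hlast] at h1
  have h2 := Finset.single_le_sum (f := fun j : Fin m =>
    if w j.succ = a then 0 else if (j : ℕ) = 0 then m + 1 else 1)
    (fun _ _ => Nat.zero_le _) (Finset.mem_univ j)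
  simp only [if_neg hj] at h2
  have : 1 ≤ if (j : ℕ) = 0 then m + 1 else 1 := by split_ifs <;> omega
  omega

/-- The letters at positions 1 and 2 both pass from position 1 to position 0, at a loss of `m + 1`
each with `m = p + 3`. This exceeds `2 * m`, the most that the uncontrolled letter appended by the
first shift can cost. -/
theorem shiftWeight_shift_shift_lt [DecidableEq α] (a : α) {p : ℕ}
    (w w' w'' : Fin (p + 4) → α) (h : ∀ j : Fin (p + 3), w' j.castSucc = w j.succ)
    (h' : ∀ j : Fin (p + 3), w'' j.castSucc = w' j.succ)
    (hlast : w'' (Fin.last (p + 3)) = a) (h1 : w 1 ≠ a) (h2 : w 2 ≠ a) :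
    shiftWeight a w'' < shiftWeight a w := by
  have e1 := shiftWeight_shift a (m := p + 3) (by omega) w w' h
  have e2 := shiftWeight_shift a (m := p + 3) (by omega) w' w'' h'
  have hw' : w' 1 ≠ a := by
    have := h 1
    rw [show (1 : Fin (p + 3)).castSucc = 1 from rfl, show (1 : Fin (p + 3)).succ = 2 from rfl]
      at this
    rwa [this]
  rw [if_pos hlast] at e2
  rw [Fin.sum_univ_succ] at e1 e2
  rw [Fin.sum_univ_succ] at e1
  simp only [show (0 : Fin (p + 3)).succ = 1 from rfl,
    show (0 : Fin (p + 2)).succ.succ = 2 from rfl, if_neg hw', if_neg h1, if_neg h2,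
    Fin.val_zero, Fin.val_succ, if_true] at e1 e2
  have : (if w' (Fin.last (p + 3)) = a then 0 else 2 * (p + 3)) ≤ 2 * (p + 3) := by
    split_ifs <;> omega
  simp only [zero_add, one_ne_zero, if_false] at e1
  omega

/-- The words whose first letter is followed by `b b a`. -/
def FreeWord (a b : α) {p : ℕ} (w : Fin (p + 4) → α) : Prop := w 1 = b ∧ w 2 = b ∧ w 3 = a

/-- A set of words that contains the constant word `a`, is invariant under a shift permutation,
and contains with a word all words that differ from it only in the first letter, unless this word
is free, contains all words. -/
theorem mem_of_shift_invariant {a b : α} (hab : a ≠ b) {p : ℕ}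
    (F : Equiv.Perm (Fin (p + 4) → α)) (hF : IsShiftPerm F)
    (O : Set (Fin (p + 4) → α)) (hz : (fun _ => a) ∈ O) (hO : ∀ w, F w ∈ O ↔ w ∈ O)
    (hfree : ∀ x y, ¬ FreeWord a b x → (∀ j : Fin (p + 3), x j.succ = y j.succ) →
      x ∈ O → y ∈ O) (w : Fin (p + 4) → α) : w ∈ O := by
  classical
  -- The preimage of `y` has the same tail as `x`, so it is as little free as `x`, and `hfree`
  -- passes membership from it to `x`.
  have append : ∀ x y : Fin (p + 4) → α, ¬ FreeWord a b x →
      (∀ j : Fin (p + 3), y j.castSucc = x j.succ) → y ∈ O → x ∈ O := by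
    intro x y hx hxy hy
    have e := hF (F.symm y)
    rw [Equiv.apply_symm_apply] at e
    have hmem : F.symm y ∈ O := by rw [← hO, Equiv.apply_symm_apply]; exact hy
    refine hfree _ _ ?_ (fun j => ?_) hmem
    · intro hf
      apply hx
      have e' : ∀ j : Fin (p + 3), F.symm y j.succ = x j.succ := fun j => by rw [← e, hxy]
      exact ⟨(e' 0).symm.trans hf.1, (e' 1).symm.trans hf.2.1, (e' 2).symm.trans hf.2.2⟩
    · rw [← e, hxy]
  have snoc_cast : ∀ (x : Fin (p + 4) → α) (j : Fin (p + 3)),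
      (Fin.snoc (Fin.tail x) a : Fin (p + 4) → α) j.castSucc = x j.succ := by
    intro x j
    rw [Fin.snoc_castSucc (α := fun _ => α)]
    rfl
  have snoc_last : ∀ x : Fin (p + 4) → α,
      (Fin.snoc (Fin.tail x) a : Fin (p + 4) → α) (Fin.last _) = a := fun x =>
    Fin.snoc_last (α := fun _ => α) _ _
  induction hn : shiftWeight a w using Nat.strong_induction_on generalizing w with
  | _ n ih =>
    subst hn
    by_cases hall : ∀ j : Fin (p + 3), w j.succ = a
    · refine append w _ ?_ (fun j => ?_) hz
      · exact fun hf => hab ((hall 0).symm.trans hf.1)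
      · exact (hall j).symm
    push Not at hall
    obtain ⟨j, hj⟩ := hall
    by_cases hf : FreeWord a b w
    -- A free word admits no choice of its successor, but the successor `b b a ...` is not free, so
    -- `a` can be appended to it; two shifts together still lower the weight.
    · rw [← hO]
      refine append (F w) (Fin.snoc (Fin.tail (F w)) a) ?_ (snoc_cast _)
        (ih _ ?_ _ rfl)
      · intro hf'
        have h3 : F w 2 = w 3 := hF w 2
        exact hab (hf.2.2.symm.trans (h3.symm.trans hf'.2.1))
      · exact shiftWeight_shift_shift_lt a w (F w) _ (hF w) (snoc_cast _) (snoc_last _)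
          (by rw [hf.1]; exact hab.symm) (by rw [hf.2.1]; exact hab.symm)
    · exact append w (Fin.snoc (Fin.tail w) a) hf (snoc_cast _)
        (ih _ (shiftWeight_shift_lt a w _ (snoc_cast _) (snoc_last _) j hj) _ rfl)

/-- Every shift permutation can be changed, away from the free words, into one with a single
cycle. -/
theorem exists_single_cycle_shiftPerm [Finite α] {a b : α} (hab : a ≠ b) {p : ℕ}
    (F₀ : Equiv.Perm (Fin (p + 4) → α)) (hF₀ : IsShiftPerm F₀) :
    ∃ F : Equiv.Perm (Fin (p + 4) → α), IsShiftPerm F ∧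
      (∀ w, FreeWord a b w → F w = F₀ w) ∧ ∀ w, F.SameCycle (fun _ => a) w := by
  classical
  -- Take `F` with the largest cycle through the constant word. If this cycle held a non-free word
  -- but not some word with the same tail, a transposition of the two would enlarge it.
  obtain ⟨F, ⟨hF, hF'⟩, hmax⟩ := Set.exists_max_image
    {F : Equiv.Perm (Fin (p + 4) → α) | IsShiftPerm F ∧ ∀ w, FreeWord a b w → F w = F₀ w}
    (fun F => Set.ncard {w | F.SameCycle (fun _ => a) w}) (Set.toFinite _)
    ⟨F₀, hF₀, fun _ _ => rfl⟩
  refine ⟨F, hF, hF', fun w => ?_⟩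
  refine mem_of_shift_invariant hab F hF {w | F.SameCycle (fun _ => a) w}
    (Equiv.Perm.SameCycle.refl _ _) (fun w => Equiv.Perm.sameCycle_apply_right) ?_ w
  intro x y hx hxy hxO
  by_contra hyO
  have hne : ¬ F.SameCycle x y := fun h => hyO (Equiv.Perm.SameCycle.trans hxO h)
  have hG : IsShiftPerm (F * Equiv.swap x y) := by
    intro t j
    rw [Equiv.Perm.mul_apply, hF]
    by_cases h1 : t = x
    · rw [h1, Equiv.swap_apply_left, hxy]
    by_cases h2 : t = y
    · rw [h2, Equiv.swap_apply_right, hxy]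
    rw [Equiv.swap_apply_of_ne_of_ne h1 h2]
  have hG' : ∀ t, FreeWord a b t → (F * Equiv.swap x y) t = F₀ t := by
    intro t ht
    rw [Equiv.Perm.mul_apply, Equiv.swap_apply_of_ne_of_ne, hF' t ht]
    · rintro rfl; exact hx ht
    · rintro rfl
      exact hx ⟨(hxy 0).trans ht.1, (hxy 1).trans ht.2.1, (hxy 2).trans ht.2.2⟩
  refine absurd (hmax _ ⟨hG, hG'⟩) (not_le.2 (Set.ncard_lt_ncard ?_ (Set.toFinite _)))
  refine (Set.ssubset_iff_of_subset fun t ht => ?_).2 ⟨y, ?_, hyO⟩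
  · exact Equiv.Perm.SameCycle.mul_swap hne ht
  · exact (Equiv.Perm.SameCycle.mul_swap hne hxO).trans
      (Equiv.Perm.sameCycle_mul_swap_of_not_sameCycle hne)

open Classical in
/-- The rotation of words, twisted by the transposition of `a` and `b` on the free words that
continue with an element of `T`. -/
noncomputable def twistedRotation (a b : α) {p : ℕ} (T : Set (Fin p → α))
    (w : Fin (p + 4) → α) : Fin (p + 4) → α :=
  Fin.snoc (Fin.tail w)
    (if (fun i : Fin p => w i.succ.succ.succ.succ) ∈ T then Equiv.swap a b (w 0) else w 0)

theorem twistedRotation_injective (a b : α) {p : ℕ} (T : Set (Fin p → α)) :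
    Function.Injective (twistedRotation a b T) := by
  classical
  intro w w' h
  obtain ⟨h1, h2⟩ := (Fin.snoc_injective2 (α := fun _ => α)) h
  have ht : ∀ j : Fin (p + 3), w j.succ = w' j.succ := fun j => congrFun h1 j
  have : w 0 = w' 0 := by
    simp only [ht] at h2
    split_ifs at h2
    · exact (Equiv.swap a b).injective h2
    · exact h2
  funext i
  exact Fin.cases this ht i

/-- There are at least `2 ^ σ ^ (k - 4)` shift permutations with a single cycle of the words of
length `k` over an alphabet of size `σ`. -/
theorem exists_injective_single_cycle_shiftPerm [Finite α] {a b : α} (hab : a ≠ b) (p : ℕ) :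
    ∃ F : Set (Fin p → α) → Equiv.Perm (Fin (p + 4) → α), Function.Injective F ∧
      ∀ T, IsShiftPerm (F T) ∧ ∀ w, (F T).SameCycle (fun _ => a) w := by
  classical
  have ex : ∀ T : Set (Fin p → α), ∃ F : Equiv.Perm (Fin (p + 4) → α), IsShiftPerm F ∧
      (∀ w, FreeWord a b w → F w = twistedRotation a b T w) ∧
        ∀ w, F.SameCycle (fun _ => a) w := by
    intro T
    refine exists_single_cycle_shiftPerm hab (Equiv.ofBijective (twistedRotation a b T)
      (Finite.injective_iff_bijective.1 (twistedRotation_injective a b T))) ?_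
    intro w j
    rw [Equiv.ofBijective_apply]
    exact Fin.snoc_castSucc (α := fun _ => α) _ _ _
  choose F hF hF' hF'' using ex
  refine ⟨F, fun T T' h => ?_, fun T => ⟨hF T, hF'' T⟩⟩
  ext t
  -- On the free word `a b b a t` the appended letter is `b` if `t ∈ T` and `a` otherwise, so `F T`
  -- determines `T`.
  let w : Fin (p + 4) → α := Fin.cons a (Fin.cons b (Fin.cons b (Fin.cons a t)))
  have hw : FreeWord a b w := ⟨rfl, rfl, rfl⟩
  have e := congrFun ((hF' T w hw).symm.trans ((congrArg (fun f => f w) h).trans (hF' T' w hw)))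
    (Fin.last _)
  unfold twistedRotation at e
  rw [Fin.snoc_last (α := fun _ => α), Fin.snoc_last (α := fun _ => α)] at e
  have hw0 : w 0 = a := rfl
  have hwt : (fun i : Fin p => w i.succ.succ.succ.succ) = t := rfl
  rw [hw0, hwt, Equiv.swap_apply_left] at e
  by_cases h1 : t ∈ T <;> by_cases h2 : t ∈ T' <;> simp_all

end ShiftPerm

/-! ### De Bruijn sequences from shift permutations, and their entropy. -/

/-- A sequence of period `N` in which every word of length `k` occurs exactly once in each
period. -/
structure IsPeriodicDeBruijn {α : Type} (k N : ℕ) (u : ℕ → α) : Prop where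
  window_eq_iff : ∀ i j, (∀ t < k, u (i + t) = u (j + t)) ↔ i ≡ j [MOD N]
  exists_window : ∀ w : List α, w.length = k → ∃ i < N, ∀ t, (h : t < w.length) → u (i + t) = w[t]

section Sequence

variable {α : Type}

theorem shiftPerm_pow_apply {m : ℕ} {F : Equiv.Perm (Fin (m + 1) → α)} (hF : IsShiftPerm F)
    (w : Fin (m + 1) → α) (t : ℕ) (ht : t < m + 1) : (F ^ t) w 0 = w ⟨t, ht⟩ := by
  induction t generalizing w with
  | zero => rfl
  | succ t ih =>
    rw [pow_succ, Equiv.Perm.mul_apply, ih (F w) (by omega)]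
    exact hF w ⟨t, by omega⟩

/-- The window at `i` in the sequence of first letters is the word `(F ^ i) z`, and the single cycle
passes through every word once per period. -/
theorem isPeriodicDeBruijn_of_shiftPerm [Fintype α] {m : ℕ} {F : Equiv.Perm (Fin (m + 1) → α)}
    (hF : IsShiftPerm F) (z : Fin (m + 1) → α) (hz : ∀ w, F.SameCycle z w) :
    IsPeriodicDeBruijn (m + 1) (Fintype.card α ^ (m + 1)) (fun i => (F ^ i) z 0) := by
  classical
  have hc : F.IsCycleOn (Finset.univ : Finset (Fin (m + 1) → α)) := by
    refine ⟨by simp, fun x _ y _ => (hz x).symm.trans (hz y)⟩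
  have hcard : (Finset.univ : Finset (Fin (m + 1) → α)).card = Fintype.card α ^ (m + 1) := by
    simp
  have hwin : ∀ i t, (ht : t < m + 1) → (F ^ (i + t)) z 0 = (F ^ i) z ⟨t, ht⟩ := by
    intro i t ht
    rw [add_comm i t, pow_add, Equiv.Perm.mul_apply, shiftPerm_pow_apply hF _ t ht]
  constructor
  · intro i j
    rw [← hcard, ← hc.pow_apply_eq_pow_apply (Finset.mem_univ z)]
    constructor
    · intro h
      funext t
      have := h t t.2
      simpa only [hwin _ _ t.2] using this
    · intro h t ht
      show (F ^ (i + t)) z 0 = (F ^ (j + t)) z 0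
      rw [hwin _ _ ht, hwin _ _ ht, h]
  · intro w hw
    obtain ⟨i, hi, e⟩ := hc.exists_pow_eq (Finset.mem_univ z)
      (Finset.mem_univ (fun t : Fin (m + 1) => w[(t : ℕ)]))
    refine ⟨i, hcard ▸ hi, fun t ht => ?_⟩
    show (F ^ (i + t)) z 0 = _
    rw [hwin _ _ (hw ▸ ht), e]

/-- The first letters of the iterates spell out the iterates themselves, and these exhaust all
words. -/
theorem shiftPerm_ext {m : ℕ} {F G : Equiv.Perm (Fin (m + 1) → α)} [Finite α]
    (hF : IsShiftPerm F) (hG : IsShiftPerm G) (z : Fin (m + 1) → α)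
    (hz : ∀ w, F.SameCycle z w) (h : ∀ i : ℕ, (F ^ i) z 0 = (G ^ i) z 0) : F = G := by
  have e : ∀ i : ℕ, (F ^ i) z = (G ^ i) z := by
    intro i
    funext t
    rw [← shiftPerm_pow_apply hF ((F ^ i) z) t t.2, ← shiftPerm_pow_apply hG ((G ^ i) z) t t.2,
      ← Equiv.Perm.mul_apply, ← Equiv.Perm.mul_apply, ← pow_add, ← pow_add, h]
  ext1 w
  obtain ⟨i, -, rfl⟩ := (hz w).exists_pow_eq'
  rw [← Equiv.Perm.mul_apply, ← pow_succ', e (i + 1), e i, pow_succ', Equiv.Perm.mul_apply]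

theorem IsPeriodicDeBruijn.apply_mod {k N : ℕ} {u : ℕ → α} (hu : IsPeriodicDeBruijn k N u)
    (hk : 0 < k) (i : ℕ) : u (i % N) = u i :=
  (hu.window_eq_iff _ _).2 (Nat.mod_modEq i N) 0 hk

/-- There are at least `2 ^ σ ^ (k - 4)` words that are one period of a De Bruijn sequence of
order `k`. -/
theorem exists_injective_isPeriodicDeBruijn [Fintype α] [Nontrivial α] (p : ℕ) :
    ∃ u : Set (Fin p → α) → ℕ → α,
      (∀ T, IsPeriodicDeBruijn (p + 4) (Fintype.card α ^ (p + 4)) (u T)) ∧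
      Function.Injective fun T => (List.range (Fintype.card α ^ (p + 4))).map (u T) := by
  obtain ⟨a, b, hab⟩ := exists_pair_ne α
  obtain ⟨F, hinj, hF⟩ := exists_injective_single_cycle_shiftPerm hab p
  have hu := fun T => isPeriodicDeBruijn_of_shiftPerm (hF T).1 _ (hF T).2
  refine ⟨fun T i => (F T ^ i) (fun _ => a) 0, hu, fun T T' h => hinj ?_⟩
  refine shiftPerm_ext (hF T).1 (hF T').1 _ (hF T).2 fun i => ?_
  have h1 := (hu T).apply_mod (Nat.succ_pos _) i
  have h2 := (hu T').apply_mod (Nat.succ_pos _) i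
  refine h1.symm.trans (Eq.trans ?_ h2)
  have hpos : 0 < Fintype.card α ^ (p + 4) := Nat.pow_pos Fintype.card_pos
  exact List.map_inj_left.1 h _ (List.mem_range.2 (Nat.mod_lt _ hpos))

theorem take_drop_map_range (u : ℕ → α) {i k L : ℕ} (h : i + k ≤ L) :
    (((List.range L).map u).drop i).take k = (List.range k).map fun t => u (i + t) := by
  apply List.ext_getElem
  · simp; omega
  · intro t h1 h2
    simp

theorem map_range_eq_iff (u : ℕ → α) (w : List α) {k : ℕ} (hw : w.length = k) :
    (List.range k).map u = w ↔ ∀ t, (h : t < w.length) → u t = w[t] := by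
  subst hw
  constructor
  · intro h t ht
    have : ((List.range w.length).map u)[t]'(by simpa using ht) = w[t] := by simp only [h]
    simpa using this
  · intro h
    apply List.ext_getElem (by simp)
    intro t h1 h2
    simpa using h t h2

/-- With `N + k - 1` letters there are exactly `N` windows, one for each residue modulo `N`. -/
theorem IsPeriodicDeBruijn.isDeBruijnSequence {σ k N : ℕ} {u : ℕ → Fin σ}
    (hu : IsPeriodicDeBruijn k N u) (hN : 0 < N) :
    IsDeBruijnSequence σ k ((List.range (N + k - 1)).map u) := by
  intro w hw
  obtain ⟨i, hi, hiw⟩ := hu.exists_window w hw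
  have hlen : ((List.range (N + k - 1)).map u).length = N + k - 1 := by simp
  refine ⟨i, ⟨by rw [hlen]; omega, ?_⟩, ?_⟩
  · rw [take_drop_map_range u (by omega), map_range_eq_iff _ w hw]
    exact hiw
  · rintro j ⟨hj, hjw⟩
    rw [hlen] at hj
    rw [take_drop_map_range u hj, map_range_eq_iff _ w hw] at hjw
    have hmod : j ≡ i [MOD N] := (hu.window_eq_iff _ _).1 fun t ht => by
      rw [hiw t (hw ▸ ht), hjw t (hw ▸ ht)]
    exact Nat.ModEq.eq_of_lt_of_lt hmod (by omega) hi

theorem flatten_replicate_map_range {u : ℕ → α} {N : ℕ} (hu : ∀ i, u (i % N) = u i) (q : ℕ) :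
    (List.replicate q ((List.range N).map u)).flatten = (List.range (q * N)).map u := by
  induction q with
  | zero => simp
  | succ q ih =>
    rw [List.replicate_succ', List.flatten_append, ih, Nat.succ_mul, List.range_add,
      List.map_append, List.map_map, List.flatten_singleton]
    congr 1
    refine List.map_congr_left fun i _ => ?_
    rw [Function.comp_apply, ← hu i, ← hu (q * N + i), Nat.mul_add_mod_self_right]

theorem repeatToLength_map_range {u : ℕ → α} {N : ℕ} (hu : ∀ i, u (i % N) = u i) (hN : 0 < N)
    (n : ℕ) : repeatToLength ((List.range N).map u) n = (List.range n).map u := by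
  unfold repeatToLength
  rw [List.length_map, List.length_range, flatten_replicate_map_range hu]
  conv_rhs => rw [← Nat.div_add_mod' n N, List.range_add, List.map_append, List.map_map]
  congr 1
  rw [← List.map_take, List.take_range, min_eq_left (Nat.mod_lt n hN).le]
  refine List.map_congr_left fun i _ => ?_
  rw [Function.comp_apply, ← hu i, ← hu (n / N * N + i), Nat.mul_add_mod_self_right]

theorem entropyZero_eq_zero [DecidableEq α] {s : List α} (h : ∀ x ∈ s, ∀ y ∈ s, x = y) :
    entropyZero s = 0 := by
  unfold entropyZero
  refine mul_eq_zero_of_right _ (Finset.sum_eq_zero fun a ha => ?_)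
  have ha' : a ∈ s := List.mem_toFinset.1 ha
  have hc : s.count a = s.length := List.count_eq_length.2 fun b hb => h a ha' b hb
  have hpos : (s.length : ℝ) ≠ 0 := by
    exact_mod_cast (List.length_pos_of_mem ha').ne'
  rw [hc, div_self hpos, Real.logb_one, mul_zero]

/-- Equal windows start at congruent positions, so they are followed by equal letters and every
`followers` list is constant. -/
theorem IsPeriodicDeBruijn.entropyOrder_eq_zero [Fintype α] [DecidableEq α] {k N : ℕ} {u : ℕ → α}
    (hu : IsPeriodicDeBruijn k N u) (hk : 0 < k) (n : ℕ) :
    entropyOrder k ((List.range n).map u) = 0 := by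
  unfold entropyOrder
  refine mul_eq_zero_of_right _ (Finset.sum_eq_zero fun w _ => mul_eq_zero_of_right _ ?_)
  have key : ∀ x ∈ followers (List.ofFn w) ((List.range n).map u),
      ∃ i, (List.range k).map (fun t => u (i + t)) = List.ofFn w ∧ x = u (i + k) := by
    intro x hx
    unfold followers at hx
    simp only [List.length_map, List.length_range, List.length_ofFn, List.mem_filterMap,
      List.mem_filter, List.mem_range, decide_eq_true_eq] at hx
    obtain ⟨i, ⟨hi, hiw⟩, hix⟩ := hx
    rw [take_drop_map_range u (by omega)] at hiw
    refine ⟨i, hiw, ?_⟩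
    rw [List.getElem?_map, List.getElem?_range (by omega)] at hix
    simpa using hix.symm
  refine entropyZero_eq_zero fun x hx y hy => ?_
  obtain ⟨i, hi, rfl⟩ := key x hx
  obtain ⟨j, hj, rfl⟩ := key y hy
  have hij : i ≡ j [MOD N] := (hu.window_eq_iff i j).1 fun t ht =>
    List.map_inj_left.1 (hi.trans hj.symm) t (List.mem_range.2 ht)
  exact (hu.window_eq_iff _ _).2 (hij.add_right k) 0 hk

end Sequence

/-! ### Counting memory states and outputs of a lossless compressor. -/

namespace OnePassCompressor

variable {α : Type} (A : OnePassCompressor α)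

theorem memoryAfter_append (m : List Bool) (s t : List α) :
    A.memoryAfter m (s ++ t) = A.memoryAfter (A.memoryAfter m s) t :=
  List.foldl_append

theorem outputWhile_append (m : List Bool) (s t : List α) :
    A.outputWhile m (s ++ t) = A.outputWhile m s ++ A.outputWhile (A.memoryAfter m s) t := by
  induction s generalizing m with
  | nil => rfl
  | cons a s ih => simp [outputWhile, memoryAfter, ih]

/-- A lossless compressor that reaches the same memory before two words of equal length, and
then outputs the same bits and reaches the same memory on them, cannot tell them apart. -/
theorem LosslessAt.eq_of_memory_of_output {A : OnePassCompressor α} {n : ℕ}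
    (hA : A.LosslessAt n) {r r' d d' : List α} (hd : d.length = d'.length)
    (hr : r.length + d.length ≤ n)
    (hm : A.memoryAfter A.init r = A.memoryAfter A.init r')
    (hm' : A.memoryAfter A.init (r ++ d) = A.memoryAfter A.init (r' ++ d'))
    (ho : A.outputWhile (A.memoryAfter A.init r) d =
      A.outputWhile (A.memoryAfter A.init r') d') : d = d' := by
  rcases d with _ | ⟨x, d⟩
  · exact (List.length_eq_zero_iff.1 hd.symm).symm
  -- Both inputs begin with `r`. The word `r'`, possibly of another length, only tells how the
  -- compressor treats `d'` from the common memory state. The letter `x` pads the inputs to length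
  -- `n`.
  have key := hA (r ++ (x :: d) ++ List.replicate (n - r.length - (x :: d).length) x)
    (r ++ d' ++ List.replicate (n - r.length - (x :: d).length) x)
    (by simp only [List.length_append, List.length_replicate]; omega)
    (by simp only [List.length_append, List.length_replicate, ← hd]; omega) ?_
  · exact List.append_cancel_left (List.append_cancel_right key)
  · rw [memoryAfter_append, memoryAfter_append] at hm'
    simp only [encode, outputWhile_append, memoryAfter_append]
    rw [ho, ← hm] at *
    rw [hm']

end OnePassCompressor

theorem card_lists_le_lt (B : ℕ) :
    ∃ S : Finset (List Bool), (∀ l, l ∈ S ↔ l.length ≤ B) ∧ S.card < 2 ^ (B + 1) := by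
  refine ⟨(List.finite_length_le Bool B).toFinset, fun l => by simp, ?_⟩
  have : (List.finite_length_le Bool B).toFinset ⊆ (Finset.range (B + 1)).biUnion
      fun i => Finset.univ.image fun v : List.Vector Bool i => v.toList := by
    intro l hl
    simp only [Set.Finite.mem_toFinset, Set.mem_ofPred_eq] at hl
    simp only [Finset.mem_biUnion, Finset.mem_range, Finset.mem_image, Finset.mem_univ, true_and]
    exact ⟨l.length, by omega, ⟨l, rfl⟩, rfl⟩
  refine (Finset.card_le_card this).trans_lt (Finset.card_biUnion_le.trans_lt ?_)
  refine (Finset.sum_le_sum fun i _ => Finset.card_image_le).trans_lt ?_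
  simp only [Finset.card_univ, card_vector, Fintype.card_bool]
  exact Nat.geomSum_lt le_rfl fun i hi => Finset.mem_range.1 hi

/-- Among sufficiently many words of the same length there is one, such that a lossless compressor
with bounded memory outputs many bits while reading each of several copies of it. -/
theorem OnePassCompressor.exists_long_output {α ι : Type} [Fintype ι] (A : OnePassCompressor α)
    {n N B U : ℕ} {R : ℝ} (hA : A.LosslessAt n) (hR : A.MemoryAtMost n R) (hB : ⌊R⌋₊ ≤ B)
    (d : ι → List α) (hd : Function.Injective d) (hN : ∀ i, (d i).length = N)
    (hcard : 2 ^ (2 * (B + 1) + (U + 1)) ≤ Fintype.card ι) :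
    ∃ i, ∀ j < n / N, U < (A.outputWhile
      (A.memoryAfter A.init (List.replicate j (d i)).flatten) (d i)).length := by
  classical
  by_contra! hbad
  choose j hj hjU using hbad
  obtain ⟨SB, hSB, hSB'⟩ := card_lists_le_lt B
  obtain ⟨SU, hSU, hSU'⟩ := card_lists_le_lt U
  have hlen : ∀ i, ∀ q : ℕ, (List.replicate q (d i)).flatten.length = q * N := by
    intro i q; simp [hN]
  have hmem : ∀ i q, q ≤ n / N →
      A.memoryAfter A.init (List.replicate q (d i)).flatten ∈ SB := by
    intro i q hq
    rw [hSB]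
    refine le_trans (Nat.le_floor ?_) hB
    have hqn : q * N ≤ n := (Nat.mul_le_mul_right N hq).trans (Nat.div_mul_le_self n N)
    rcases Nat.eq_zero_or_pos (n / N) with h0 | h0
    · exact absurd (hj i) (by omega)
    have hNpos : 0 < N := Nat.pos_of_ne_zero fun e => by simp [e] at h0
    -- The memory bound concerns prefixes of inputs of length `n`, so the copies are padded by some
    -- letter.
    have x : α := (d i)[0]'(by rw [hN]; exact hNpos)
    refine hR ((List.replicate q (d i)).flatten ++ List.replicate (n - q * N) x) ?_ _
      (List.prefix_append _ _)
    rw [List.length_append, hlen, List.length_replicate]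
    omega
  have hsucc : ∀ i, (List.replicate (j i + 1) (d i)).flatten =
      (List.replicate (j i) (d i)).flatten ++ d i := by
    intro i
    rw [List.replicate_succ', List.flatten_append, List.flatten_singleton]
  -- The triple of memory before, memory after and output on the cheap copy, whose index `j i` need
  -- not be recorded.
  let f : ι → List Bool × List Bool × List Bool := fun i =>
    (A.memoryAfter A.init (List.replicate (j i) (d i)).flatten,
      A.memoryAfter A.init (List.replicate (j i + 1) (d i)).flatten,
      A.outputWhile (A.memoryAfter A.init (List.replicate (j i) (d i)).flatten) (d i))
  have hf : Function.Injective f := by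
    intro i i' h
    simp only [f, Prod.mk.injEq, hsucc] at h
    refine hd (hA.eq_of_memory_of_output (by rw [hN, hN]) ?_ h.1 h.2.1 h.2.2)
    rw [hlen, hN, ← Nat.succ_mul]
    exact (Nat.mul_le_mul_right N (hj i)).trans (Nat.div_mul_le_self n N)
  have hsub : Finset.univ.image f ⊆ SB ×ˢ SB ×ˢ SU := by
    intro t ht
    obtain ⟨i, -, rfl⟩ := Finset.mem_image.1 ht
    simp only [Finset.mem_product]
    exact ⟨hmem i _ (hj i).le, hmem i _ (hj i), (hSU _).2 (hjU i)⟩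
  have h1 := Finset.card_le_card hsub
  rw [Finset.card_image_of_injective _ hf, Finset.card_product, Finset.card_product,
    Finset.card_univ] at h1
  have h2 : SB.card * (SB.card * SU.card) < 2 ^ (B + 1) * (2 ^ (B + 1) * 2 ^ (U + 1)) := by
    gcongr
  rw [← pow_add, ← pow_add] at h2
  have : B + 1 + (B + 1 + (U + 1)) = 2 * (B + 1) + (U + 1) := by ring
  rw [this] at h2
  omega

theorem OnePassCompressor.mul_le_length_outputWhile {α : Type} (A : OnePassCompressor α)
    (d : List α) {U : ℝ} (q : ℕ)
    (h : ∀ j < q, U ≤ ((A.outputWhile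
      (A.memoryAfter A.init (List.replicate j d).flatten) d).length : ℝ)) :
    q * U ≤ ((A.outputWhile A.init (List.replicate q d).flatten).length : ℝ) := by
  induction q with
  | zero => simp
  | succ q ih =>
    have h1 := ih fun j hj => h j (by omega)
    have h2 := h q (by omega)
    rw [List.replicate_succ', List.flatten_append, List.flatten_singleton,
      A.outputWhile_append, List.length_append]
    push_cast
    linarith

theorem OnePassCompressor.mul_le_length_encode_repeatToLength {α : Type}
    (A : OnePassCompressor α) (d : List α) {U : ℝ} {n : ℕ}
    (h : ∀ j < n / d.length, U ≤ ((A.outputWhile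
      (A.memoryAfter A.init (List.replicate j d).flatten) d).length : ℝ)) :
    ((n / d.length : ℕ) : ℝ) * U ≤ ((A.encode (repeatToLength d n)).length : ℝ) := by
  refine (A.mul_le_length_outputWhile d _ h).trans ?_
  rw [encode, repeatToLength, A.outputWhile_append]
  simp only [List.length_append]
  push_cast
  have h1 : (0 : ℝ) ≤ ((A.outputWhile (A.memoryAfter A.init
    (List.replicate (n / d.length) d).flatten) (d.take (n % d.length))).length : ℝ) :=
    Nat.cast_nonneg _
  have h2 : (0 : ℝ) ≤ ((A.finish (A.memoryAfter A.init
    ((List.replicate (n / d.length) d).flatten ++ d.take (n % d.length)))).length : ℝ) :=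
    Nat.cast_nonneg _
  linarith

/-! ### Choice of parameters and asymptotics. -/

theorem pow_ceil_logb_bounds {σ : ℕ} (hσ : 2 ≤ σ) {γ : ℝ} (hγ : 0 ≤ γ) {n : ℕ} (hn : 1 ≤ n) :
    (n : ℝ) ^ γ ≤ (σ : ℝ) ^ ⌈γ * Real.logb σ n⌉₊ ∧
      (σ : ℝ) ^ ⌈γ * Real.logb σ n⌉₊ ≤ σ * (n : ℝ) ^ γ := by
  have hσ1 : (1 : ℝ) < σ := by exact_mod_cast hσ
  have hσ0 : (0 : ℝ) < σ := by linarith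
  have hn0 : (0 : ℝ) < n := by exact_mod_cast hn
  have hlog : 0 ≤ γ * Real.logb σ n :=
    mul_nonneg hγ (Real.logb_nonneg hσ1 (by exact_mod_cast hn))
  have e : (n : ℝ) ^ γ = (σ : ℝ) ^ (γ * Real.logb σ n) := by
    rw [mul_comm, Real.rpow_mul hσ0.le, Real.rpow_logb hσ0 hσ1.ne' hn0]
  rw [e, ← Real.rpow_natCast]
  constructor
  · exact Real.rpow_le_rpow_of_exponent_le hσ1.le (Nat.le_ceil _)
  · calc (σ : ℝ) ^ ((⌈γ * Real.logb σ n⌉₊ : ℕ) : ℝ) ≤ (σ : ℝ) ^ (γ * Real.logb σ n + 1) :=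
          Real.rpow_le_rpow_of_exponent_le hσ1.le (Nat.ceil_lt_add_one hlog).le
      _ = σ * (σ : ℝ) ^ (γ * Real.logb σ n) := by
          rw [Real.rpow_add hσ0, Real.rpow_one, mul_comm]

theorem eventually_lt_natCast_rpow {γ : ℝ} (hγ : 0 < γ) (M : ℝ) :
    ∀ᶠ n : ℕ in Filter.atTop, M < (n : ℝ) ^ γ :=
  ((tendsto_rpow_atTop hγ).comp tendsto_natCast_atTop_atTop).eventually_gt_atTop M

/-- A lossless compressor with memory `R` far below `σ ^ k` outputs many bits on copies of some
prefix of a De Bruijn sequence of order `k`. -/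
theorem OnePassCompressor.exists_deBruijn_long_output {σ : ℕ} (hσ : 2 ≤ σ)
    (A : OnePassCompressor (Fin σ)) {n k : ℕ} {R : ℝ} (hk : 4 ≤ k) (hR0 : 0 ≤ R)
    (hA : A.LosslessAt n) (hR : A.MemoryAtMost n R) (hkn : σ ^ k ≤ n)
    (hRk : 2 * (σ : ℝ) ^ 4 * (2 * R + 3) ≤ (σ : ℝ) ^ k) :
    ∃ b d s : List (Fin σ),
      IsDeBruijnSequence σ k b ∧ d = b.take (σ ^ k) ∧ d.length = σ ^ k ∧
      s = repeatToLength d n ∧ s.length = n ∧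
      entropyOrder k s = 0 ∧
      (∀ j : ℕ, j < n / σ ^ k →
        1 / (8 * (σ : ℝ) ^ 4) * (σ : ℝ) ^ k ≤
          ((A.outputWhile
            (A.memoryAfter A.init (List.replicate j d).flatten) d).length : ℝ)) ∧
      1 / (8 * (σ : ℝ) ^ 4) * (n : ℝ) ≤ ((A.encode s).length : ℝ) := by
  classical
  obtain ⟨p, rfl⟩ := Nat.exists_eq_add_of_le' hk
  have : Nontrivial (Fin σ) := Fin.nontrivial_iff_two_le.2 hσ
  obtain ⟨u, hu, hinj⟩ := exists_injective_isPeriodicDeBruijn (α := Fin σ) p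
  simp only [Fintype.card_fin] at hu hinj
  have hσ0 : (0 : ℝ) < σ := by exact_mod_cast (by omega : 0 < σ)
  have hNpos : 0 < σ ^ (p + 4) := Nat.pow_pos (by omega)
  have hNreal : (0 : ℝ) < (σ : ℝ) ^ (p + 4) := by positivity
  have hsplit : (σ : ℝ) ^ (p + 4) = (σ : ℝ) ^ p * (σ : ℝ) ^ 4 := pow_add _ _ _
  have hR' : 2 * R + 3 ≤ (σ : ℝ) ^ p / 2 := by
    rw [hsplit] at hRk
    have h4 : (0 : ℝ) < (σ : ℝ) ^ 4 := by positivity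
    have : (σ : ℝ) ^ 4 * (2 * (2 * R + 3)) ≤ (σ : ℝ) ^ 4 * (σ : ℝ) ^ p := by linarith
    linarith [le_of_mul_le_mul_left this h4]
  obtain ⟨T, hT⟩ := A.exists_long_output (U := ⌊(σ : ℝ) ^ p / 4⌋₊) hA hR le_rfl _ hinj
    (N := σ ^ (p + 4)) (fun T => by simp) (by
      rw [Fintype.card_set, Fintype.card_fun, Fintype.card_fin, Fintype.card_fin]
      -- The family has `2 ^ σ ^ p` members. By `hR'`, memory and rounding take at most half of the
      -- exponent, which leaves room for `σ ^ p / 4` bits of output.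
      refine Nat.pow_le_pow_right (by norm_num) ?_
      have h1 := Nat.floor_le hR0
      have h2 := Nat.floor_le (by positivity : (0 : ℝ) ≤ (σ : ℝ) ^ p / 4)
      have h3 : (0 : ℝ) ≤ (σ : ℝ) ^ p := by positivity
      have : (((2 * (⌊R⌋₊ + 1) + (⌊(σ : ℝ) ^ p / 4⌋₊ + 1) : ℕ)) : ℝ) ≤ ((σ ^ p : ℕ) : ℝ) := by
        push_cast
        linarith
      exact_mod_cast this)
  have hper := (hu T).apply_mod (Nat.succ_pos _)
  have hd : ((List.range (σ ^ (p + 4))).map (u T)).length = σ ^ (p + 4) := by simp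
  have hout : ∀ j < n / σ ^ (p + 4), (σ : ℝ) ^ p / 4 ≤ ((A.outputWhile
      (A.memoryAfter A.init (List.replicate j ((List.range (σ ^ (p + 4))).map (u T))).flatten)
      ((List.range (σ ^ (p + 4))).map (u T))).length : ℝ) := fun j hj => by
    refine (Nat.lt_floor_add_one _).le.trans ?_
    exact_mod_cast hT j hj
  refine ⟨_, _, _, (hu T).isDeBruijnSequence hNpos, ?_, hd, rfl, ?_, ?_, ?_, ?_⟩
  · rw [← List.map_take, List.take_range, min_eq_left (by omega)]
  · rw [repeatToLength_map_range hper hNpos]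
    simp
  · rw [repeatToLength_map_range hper hNpos]
    exact (hu T).entropyOrder_eq_zero (Nat.succ_pos _) n
  · intro j hj
    refine le_trans ?_ (hout j hj)
    rw [hsplit]
    have h3 : (0 : ℝ) ≤ (σ : ℝ) ^ p := by positivity
    have : 1 / (8 * (σ : ℝ) ^ 4) * ((σ : ℝ) ^ p * (σ : ℝ) ^ 4) = (σ : ℝ) ^ p / 8 := by
      field_simp
    linarith
  · have h1 := A.mul_le_length_encode_repeatToLength
      ((List.range (σ ^ (p + 4))).map (u T)) (U := (σ : ℝ) ^ p / 4) (n := n) (by rwa [hd])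
    rw [hd] at h1
    refine le_trans ?_ h1
    -- As at least one copy is complete, the complete copies cover half of the input. This factor 2
    -- turns the 4 in the cost of a copy into the 8 in the constant.
    have h2 : n ≤ 2 * (n / σ ^ (p + 4) * σ ^ (p + 4)) := by
      have h3 := Nat.lt_div_mul_add (a := n) hNpos
      have h4 : 1 * σ ^ (p + 4) ≤ n / σ ^ (p + 4) * σ ^ (p + 4) :=
        Nat.mul_le_mul_right _ ((Nat.one_le_div_iff hNpos).2 hkn)
      omega
    have h3 : (n : ℝ) ≤ 2 * (((n / σ ^ (p + 4) : ℕ) : ℝ) * (σ : ℝ) ^ (p + 4)) := by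
      exact_mod_cast h2
    calc 1 / (8 * (σ : ℝ) ^ 4) * (n : ℝ)
        ≤ 1 / (8 * (σ : ℝ) ^ 4) * (2 * (((n / σ ^ (p + 4) : ℕ) : ℝ) * (σ : ℝ) ^ (p + 4))) := by
          gcongr
      _ = ((n / σ ^ (p + 4) : ℕ) : ℝ) * ((σ : ℝ) ^ p / 4) := by
          rw [hsplit]
          field_simp
          ring

/-- `A n` is the compressor as it works on inputs of length `n`; an algorithm that does not know
the length of its input in advance is the case of a constant `A`. -/
theorem theorem2 (σ : ℕ) (hσ : 2 ≤ σ) (c ε : ℝ) (hε : 0 < ε) (hεc : ε < c) (hcε : c < 1 - ε)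
    (A : ℕ → OnePassCompressor (Fin σ))
    (hlossless : ∀ n : ℕ, (A n).LosslessAt n)
    (hmemory : ∃ K : ℝ, ∀ᶠ n : ℕ in Filter.atTop, (A n).MemoryAtMost n (K * (n : ℝ) ^ c))
    (k : ℕ → ℕ) (hk : ∀ n : ℕ, k n = ⌈(c + ε / 2) * Real.logb (σ : ℝ) (n : ℝ)⌉₊) :
    -- The bound fails, for every constant factor `C` and every large enough length.
    (∀ C : ℝ, ∀ᶠ n : ℕ in Filter.atTop, ∃ s : List (Fin σ), s.length = n ∧
      C * ((n : ℝ) * entropyOrder (k n) s + (σ : ℝ) ^ k n * (n : ℝ) ^ (1 - c - ε)) <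
        (((A n).encode s).length : ℝ)) ∧
    -- It fails on copies of a prefix `d` of a De Bruijn sequence.
    (∃ δ : ℝ, 0 < δ ∧ ∀ᶠ n : ℕ in Filter.atTop, ∃ b d s : List (Fin σ),
      IsDeBruijnSequence σ (k n) b ∧ d = b.take (σ ^ k n) ∧ d.length = σ ^ k n ∧
      s = repeatToLength d n ∧ s.length = n ∧
      entropyOrder (k n) s = 0 ∧
      (∀ j : ℕ, j < n / σ ^ k n →
        δ * (σ : ℝ) ^ k n ≤
          (((A n).outputWhile
            ((A n).memoryAfter (A n).init (List.replicate j d).flatten) d).length : ℝ)) ∧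
      δ * (n : ℝ) ≤ (((A n).encode s).length : ℝ)) := by
  have hσ0 : (0 : ℝ) < σ := by exact_mod_cast (by omega : 0 < σ)
  have hγ : 0 ≤ c + ε / 2 := by linarith
  obtain ⟨K, hK⟩ := hmemory
  have main : ∀ᶠ n : ℕ in Filter.atTop, ∃ b d s : List (Fin σ),
      IsDeBruijnSequence σ (k n) b ∧ d = b.take (σ ^ k n) ∧ d.length = σ ^ k n ∧
      s = repeatToLength d n ∧ s.length = n ∧
      entropyOrder (k n) s = 0 ∧
      (∀ j : ℕ, j < n / σ ^ k n →
        1 / (8 * (σ : ℝ) ^ 4) * (σ : ℝ) ^ k n ≤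
          (((A n).outputWhile
            ((A n).memoryAfter (A n).init (List.replicate j d).flatten) d).length : ℝ)) ∧
      1 / (8 * (σ : ℝ) ^ 4) * (n : ℝ) ≤ (((A n).encode s).length : ℝ) := by
    -- The three growth conditions give, in this order, `4 ≤ k n`, `σ ^ k n ≤ n`, and a memory bound
    -- small enough against `σ ^ k n`.
    filter_upwards [hK, Filter.eventually_ge_atTop 1,
      eventually_lt_natCast_rpow (by linarith : 0 < c + ε / 2) ((σ : ℝ) ^ 4),
      eventually_lt_natCast_rpow (by linarith : 0 < 1 - (c + ε / 2)) σ,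
      eventually_lt_natCast_rpow (by linarith : 0 < ε / 2) (2 * (σ : ℝ) ^ 4 * (2 * |K| + 3))]
      with n hKn hn h4 hlt hbig
    obtain ⟨hlo, hhi⟩ := pow_ceil_logb_bounds hσ hγ hn
    rw [← hk n] at hlo hhi
    have hn0 : (0 : ℝ) < n := by exact_mod_cast hn
    have hn1 : (1 : ℝ) ≤ n := by exact_mod_cast hn
    have hnc : 1 ≤ (n : ℝ) ^ c := Real.one_le_rpow hn1 (by linarith)
    refine (A n).exists_deBruijn_long_output hσ (R := |K| * (n : ℝ) ^ c) ?_ (by positivity)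
      (hlossless n) ?_ ?_ ?_
    · have : σ ^ 4 < σ ^ k n := by exact_mod_cast h4.trans_le hlo
      exact ((Nat.pow_lt_pow_iff_right (by omega)).1 this).le
    · intro s hs t ht
      refine (hKn s hs t ht).trans ?_
      gcongr
      exact le_abs_self K
    · have : (σ : ℝ) ^ k n ≤ n := by
        refine hhi.trans ?_
        calc (σ : ℝ) * (n : ℝ) ^ (c + ε / 2)
            ≤ (n : ℝ) ^ (1 - (c + ε / 2)) * (n : ℝ) ^ (c + ε / 2) := by gcongr
          _ = n := by rw [← Real.rpow_add hn0, sub_add_cancel, Real.rpow_one]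
      exact_mod_cast this
    · calc 2 * (σ : ℝ) ^ 4 * (2 * (|K| * (n : ℝ) ^ c) + 3)
          ≤ 2 * (σ : ℝ) ^ 4 * (2 * (|K| * (n : ℝ) ^ c) + 3 * (n : ℝ) ^ c) := by
            gcongr
            linarith
        _ = (n : ℝ) ^ c * (2 * (σ : ℝ) ^ 4 * (2 * |K| + 3)) := by ring
        _ ≤ (n : ℝ) ^ c * (n : ℝ) ^ (ε / 2) := by gcongr
        _ = (n : ℝ) ^ (c + ε / 2) := by rw [← Real.rpow_add hn0]
        _ ≤ (σ : ℝ) ^ k n := hlo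
  refine ⟨fun C => ?_, 1 / (8 * (σ : ℝ) ^ 4), by positivity, main⟩
  filter_upwards [main, Filter.eventually_ge_atTop 1,
    eventually_lt_natCast_rpow (by linarith : 0 < ε / 2) (8 * (σ : ℝ) ^ 4 * (|C| * σ))]
    with n ⟨b, d, s, _, _, _, _, hs, hH, _, hlen⟩ hn hbig
  refine ⟨s, hs, lt_of_lt_of_le ?_ hlen⟩
  obtain ⟨-, hhi⟩ := pow_ceil_logb_bounds hσ hγ hn
  rw [← hk n] at hhi
  have hn0 : (0 : ℝ) < n := by exact_mod_cast hn
  rw [hH, mul_zero, zero_add]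
  -- Since the entropy vanishes, the claimed bound is of order at most `n ^ (1 - ε / 2)`, which is
  -- less than any fixed multiple of `n` for large `n`.
  calc C * ((σ : ℝ) ^ k n * (n : ℝ) ^ (1 - c - ε))
      ≤ |C| * (σ * (n : ℝ) ^ (c + ε / 2) * (n : ℝ) ^ (1 - c - ε)) := by
        gcongr
        exact le_abs_self C
    _ = 1 / (8 * (σ : ℝ) ^ 4) * (8 * (σ : ℝ) ^ 4 * (|C| * σ) * (n : ℝ) ^ (1 - ε / 2)) := by
        rw [mul_assoc (σ : ℝ), ← Real.rpow_add hn0,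
          show (c + ε / 2) + (1 - c - ε) = 1 - ε / 2 by ring]
        generalize (n : ℝ) ^ (1 - ε / 2) = x
        field_simp
    _ < 1 / (8 * (σ : ℝ) ^ 4) * ((n : ℝ) ^ (ε / 2) * (n : ℝ) ^ (1 - ε / 2)) := by
        gcongr
    _ = 1 / (8 * (σ : ℝ) ^ 4) * (n : ℝ) := by
        rw [← Real.rpow_add hn0, add_sub_cancel, Real.rpow_one]
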